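/- For a positive integer $n$ call an integer $a$ regular (mod $n$) if there is an integer $x$ with $a^2x\equiv a \pmod n$, and let $\varrho(n)$ denote the number of integers $a$ with $1\le a\le n$ that are regular (mod $n$). Let $\phi$ be Euler's totient function and $\gamma$ Euler's constant. The minimal order of $\varrho$ is the same as that of $\phi$, namely $$\liminf_{n\to\infty}\frac{\varrho(n)\log\log n}{n}=e^{-\gamma}=\liminf_{n\to\infty}\frac{\phi(n)\log\log n}{n}.$$ -/

import Mathlib

/-- An integer `a` is regular modulo `n` if `a ^ 2 * x ≡ a (mod n)` for some integer `x`. -/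
def IsRegularMod (n : ℕ) (a : ℤ) : Prop :=
  ∃ x : ℤ, a ^ 2 * x ≡ a [ZMOD (n : ℤ)]

open Classical in
/-- The set of the integers `1 ≤ a ≤ n` that are regular modulo `n`. -/
noncomputable def regularIntegers (n : ℕ) : Finset ℕ :=
  (Finset.Icc 1 n).filter fun a => IsRegularMod n (a : ℤ)

/-- `regularCount n` is the number `ϱ(n)` of regular integers modulo `n` in `{1, …, n}`. -/
noncomputable def regularCount (n : ℕ) : ℕ :=
  (regularIntegers n).card

/-! Units are regular, so `φ ≤ ϱ`, and it suffices to bound `φ` below for all `n` and `ϱ` above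
along one sequence.

Below: `n` has at most `log n / log log n` prime factors exceeding `log n`, and they cost `φ(n)/n`
only a factor `1 - 1 / log log n`. The other factors are at least `∏ (1 - 1/p)` over all `p ≤ log
n`, to which Mertens' third theorem applies.

Above: for squarefree `n` everything is regular, so high powers are needed. Take `n = (m#)^k` with
`2^k ≥ m^2` and `k = O(log m)`. A regular `a` divisible by a prime `p ≤ m` is divisible by `p^k`, so
the regular non-units number at most `n/m`, while `log log n ~ log m`.

Mertens' third theorem rests on the second, `∑ 1/p - log log n → M`. To identify the constant, the
Laplace transform of `∑_{log p ≤ u} 1/p` is compared with that of the harmonic numbers, which are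
`log u + γ + o(1)`. This gives `∑ p^(-1-s) + log s → M - γ`. The Euler product and the pole of `ζ`
at `1` evaluate the same limit as `-∑ (-log (1 - 1/p) - 1/p)`. -/

open Filter Topology Finset MeasureTheory

/-! ### Mertens' first theorem -/

/-- Legendre's formula in logarithmic form. -/
theorem log_factorial_eq_sum_primesLE (n : ℕ) :
    Real.log (n.factorial : ℝ) =
      ∑ p ∈ Nat.primesLE n, (n.factorial.factorization p : ℝ) * Real.log p := by
  rw [Real.log_nat_eq_sum_factorization, Finsupp.sum]
  apply Finset.sum_subset
  · intro p hp
    rw [Nat.support_factorization, Nat.mem_primeFactors] at hp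
    exact Nat.mem_primesLE.2 ⟨(hp.1.dvd_factorial).1 hp.2.1, hp.1⟩
  · intro p _ hp
    rw [Finsupp.notMem_support_iff] at hp
    simp [hp]

/-- This is the cost of replacing `1/(p-1)` by `1/p` in Legendre's formula. Since `log p ≤ 2√p`, the
terms are `O(p^(-3/2))`. -/
theorem sum_log_div_mul_pred_bounded :
    ∃ K : ℝ, ∀ n : ℕ, ∑ p ∈ Nat.primesLE n, Real.log p / ((p : ℝ) * (p - 1)) ≤ K := by
  have hs : Summable fun n : ℕ => 4 * (n : ℝ) ^ (-(3 / 2) : ℝ) :=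
    (Real.summable_nat_rpow.2 (by norm_num)).mul_left 4
  refine ⟨∑' n : ℕ, 4 * (n : ℝ) ^ (-(3 / 2) : ℝ), fun n => ?_⟩
  refine le_trans (Finset.sum_le_sum fun p hp => ?_)
    (hs.sum_le_tsum (Nat.primesLE n) fun i _ => by positivity)
  have h2 : (2 : ℝ) ≤ p := by exact_mod_cast Nat.two_le_of_mem_primesLE hp
  have hlog : Real.log p ≤ 2 * (p : ℝ) ^ (1 / 2 : ℝ) := by
    have := Real.log_natCast_le_rpow_div p (show (0 : ℝ) < 1 / 2 by norm_num)
    linarith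
  have hp0 : (0 : ℝ) < p := by linarith
  have e : (p : ℝ) ^ (-(3 / 2) : ℝ) = (p : ℝ) ^ (1 / 2 : ℝ) / (p : ℝ) ^ 2 := by
    rw [← Real.rpow_natCast, ← Real.rpow_sub hp0]; norm_num
  rw [e, ← mul_div_assoc, div_le_div_iff₀ (by nlinarith) (by positivity)]
  have hr : 0 ≤ (p : ℝ) ^ (1 / 2 : ℝ) := by positivity
  calc Real.log p * (p : ℝ) ^ 2 ≤ (2 * (p : ℝ) ^ (1 / 2 : ℝ)) * (p : ℝ) ^ 2 := by gcongr
    _ ≤ (2 * (p : ℝ) ^ (1 / 2 : ℝ)) * (2 * (p * (p - 1))) := by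
        gcongr; nlinarith
    _ = _ := by ring

/-- Mertens' first theorem. -/
theorem abs_sum_log_div_sub_log_le :
    ∃ C : ℝ, ∀ n : ℕ, |∑ p ∈ Nat.primesLE n, Real.log p / (p : ℝ) - Real.log n| ≤ C := by
  obtain ⟨K, hK⟩ := sum_log_div_mul_pred_bounded
  refine ⟨max (1 + K) (Real.log 4), fun n => ?_⟩
  rcases Nat.eq_zero_or_pos n with rfl | hn
  · simp only [Nat.primesLE_zero, sum_empty, Nat.cast_zero, Real.log_zero, sub_zero, abs_zero]
    exact le_max_of_le_right (Real.log_nonneg (by norm_num))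
  have hn0 : (0 : ℝ) < n := by exact_mod_cast hn
  have hn1 : (1 : ℝ) ≤ n := by exact_mod_cast hn
  set S := ∑ p ∈ Nat.primesLE n, Real.log p / (p : ℝ) with hS
  have hfac := log_factorial_eq_sum_primesLE n
  have hlower : n * Real.log n - n ≤ Real.log (n.factorial : ℝ) := by
    have h1 := Stirling.le_log_factorial_stirling hn.ne'
    have h2 := Real.log_nonneg hn1
    have h3 : 0 ≤ Real.log (2 * Real.pi) :=
      Real.log_nonneg (by linarith [Real.pi_gt_three])
    linarith
  have hupper : Real.log (n.factorial : ℝ) ≤ n * Real.log n := by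
    rw [← Real.log_pow]
    exact Real.log_le_log (by exact_mod_cast n.factorial_pos)
      (by exact_mod_cast Nat.factorial_le_pow n)
  -- `v_p(n!) ≤ n/(p-1)`, and `1/(p-1) = 1/p + 1/(p(p-1))`.
  have hA : Real.log (n.factorial : ℝ) ≤ n * (S + K) := by
    calc Real.log (n.factorial : ℝ)
        ≤ ∑ p ∈ Nat.primesLE n,
          n * (Real.log p / (p : ℝ) + Real.log p / ((p : ℝ) * (p - 1))) := by
          rw [hfac]
          refine Finset.sum_le_sum fun p hp => ?_
          have hpp := Nat.prime_of_mem_primesLE hp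
          have h2 : (2 : ℝ) ≤ p := by exact_mod_cast hpp.two_le
          have hv : (n.factorial.factorization p : ℝ) ≤ n / ((p : ℝ) - 1) := by
            have h := Nat.factorization_factorial_le_div_pred hpp n
            have h' : ((n / (p - 1) : ℕ) : ℝ) ≤ (n : ℝ) / ((p - 1 : ℕ) : ℝ) := Nat.cast_div_le
            rw [Nat.cast_pred hpp.pos] at h'
            refine le_trans ?_ h'
            exact_mod_cast h
          have hl : 0 ≤ Real.log p := Real.log_nonneg (by linarith)
          refine (mul_le_mul_of_nonneg_right hv hl).trans (le_of_eq ?_)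
          have : (p : ℝ) - 1 ≠ 0 := by linarith
          have : (p : ℝ) ≠ 0 := by linarith
          field_simp
          ring
      _ = n * (S + ∑ p ∈ Nat.primesLE n, Real.log p / ((p : ℝ) * (p - 1))) := by
          rw [← Finset.mul_sum, Finset.sum_add_distrib]
      _ ≤ _ := by gcongr; exact hK n
  -- `v_p(n!) ≥ ⌊n/p⌋ > n/p - 1`; the lost ones sum to `θ(n) ≤ n log 4`.
  have hB : n * S - Real.log 4 * n ≤ Real.log (n.factorial : ℝ) := by
    calc n * S - Real.log 4 * n ≤ n * S - Chebyshev.theta n := by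
          gcongr; exact Chebyshev.theta_le_log4_mul_x hn0.le
      _ = ∑ p ∈ Nat.primesLE n, ((n : ℝ) / p - 1) * Real.log p := by
          rw [Chebyshev.theta_eq_sum_primesLE_log, hS, Finset.mul_sum, ← Finset.sum_sub_distrib]
          refine Finset.sum_congr rfl fun p _ => by ring
      _ ≤ _ := by
          rw [hfac]
          refine Finset.sum_le_sum fun p hp => ?_
          have hpp := Nat.prime_of_mem_primesLE hp
          refine mul_le_mul_of_nonneg_right ?_
            (Real.log_nonneg (by exact_mod_cast hpp.one_le))
          have h1 : n / p ≤ n.factorial.factorization p := by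
            rw [Nat.factorization_factorial hpp (Nat.lt_succ_self _)]
            have : 1 ∈ Finset.Ico 1 (Nat.log p n).succ := by
              simp only [Finset.mem_Ico, le_refl, true_and]
              have := Nat.log_pos hpp.one_lt (Nat.le_of_mem_primesLE hp)
              omega
            simpa using Finset.single_le_sum (f := fun i => n / p ^ i) (fun _ _ => Nat.zero_le _) this
          have h2 : (n : ℝ) / p < ((n / p : ℕ) : ℝ) + 1 := by
            rw [← Nat.floor_div_eq_div (K := ℝ)]
            exact Nat.lt_floor_add_one _
          have h3 : ((n / p : ℕ) : ℝ) ≤ n.factorial.factorization p := by exact_mod_cast h1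
          linarith
  have e1 : Real.log n ≤ S + K + 1 := by
    refine le_of_mul_le_mul_left ?_ hn0
    nlinarith
  have e2 : S ≤ Real.log n + Real.log 4 := by
    refine le_of_mul_le_mul_left ?_ hn0
    nlinarith
  rw [abs_le]
  constructor
  · linarith [le_max_left (1 + K) (Real.log 4)]
  · linarith [le_max_right (1 + K) (Real.log 4)]

/-! ### Mertens' second theorem by partial summation -/

theorem sum_primesLE_succ_eq_sum_range (f : ℕ → ℝ) (N : ℕ) :
    ∑ p ∈ Nat.primesLE (N + 1), f p =
      ∑ i ∈ range N, if (i + 2).Prime then f (i + 2) else 0 := by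
  induction N with
  | zero => simp
  | succ N ih =>
    rw [Finset.sum_range_succ, ← ih, Nat.primesLE_succ]
    split_ifs with h
    · rw [Finset.sum_insert (Nat.notMem_primesLE _), add_comm]
    · simp

/-- A Riemann sum for `∫ dx/x` in `x = log t`. The sequence decreases, and it increases once `1 /
log (N + 2)` is subtracted, so it is bounded below. -/
theorem exists_tendsto_sum_log_sub_div_log :
    ∃ l : ℝ, Tendsto (fun N : ℕ =>
      ∑ i ∈ range (N + 1), (Real.log (i + 2) - Real.log (i + 1)) / Real.log (i + 2)
        - Real.log (Real.log (N + 2))) atTop (𝓝 l) := by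
  set G : ℕ → ℝ := fun N =>
      ∑ i ∈ range (N + 1), (Real.log (i + 2) - Real.log (i + 1)) / Real.log (i + 2)
        - Real.log (Real.log (N + 2)) with hG
  have key : ∀ N : ℕ, G (N + 1) ≤ G N ∧
      G N - 1 / Real.log (N + 2) ≤ G (N + 1) - 1 / Real.log ((N + 1 : ℕ) + 2) := by
    intro N
    have hN : (0 : ℝ) ≤ N := N.cast_nonneg
    set a := Real.log ((N : ℝ) + 2) with ha
    set b := Real.log ((N : ℝ) + 3) with hb
    have ha0 : 0 < a := Real.log_pos (by linarith)
    have hab : a ≤ b := Real.log_le_log (by linarith) (by linarith)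
    have hb0 : 0 < b := ha0.trans_le hab
    have hba1 : b - a ≤ 1 := by
      rw [hb, ha, ← Real.log_div (by linarith) (by linarith)]
      refine (Real.log_le_sub_one_of_pos (by positivity)).trans ?_
      rw [sub_le_iff_le_add, div_le_iff₀ (by linarith)]
      linarith
    have e : G (N + 1) = G N + ((b - a) / b - (Real.log b - Real.log a)) := by
      simp only [hG]
      rw [Finset.sum_range_succ _ (N + 1)]
      have e1 : (((N + 1 : ℕ) : ℝ) + 2) = N + 3 := by push_cast; ring
      have e2 : (((N + 1 : ℕ) : ℝ) + 1) = N + 2 := by push_cast; ring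
      rw [e1, e2]
      ring
    have e1 : (((N + 1 : ℕ) : ℝ) + 2) = N + 3 := by push_cast; ring
    rw [e1, e]
    have h1 : (b - a) / b ≤ Real.log b - Real.log a := by
      have := Real.log_le_sub_one_of_pos (show 0 < a / b by positivity)
      rw [Real.log_div ha0.ne' hb0.ne'] at this
      have : (b - a) / b = 1 - a / b := by field_simp
      linarith
    have h2 : Real.log b - Real.log a ≤ (b - a) / a := by
      have := Real.log_le_sub_one_of_pos (show 0 < b / a by positivity)
      rw [Real.log_div hb0.ne' ha0.ne'] at this
      have : (b - a) / a = b / a - 1 := by field_simp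
      linarith
    refine ⟨by linarith, ?_⟩
    -- The one-step error telescopes because `b - a ≤ 1`.
    have h3 : (b - a) / a - (b - a) / b ≤ 1 / a - 1 / b := by
      have h4 : 1 / b ≤ 1 / a := one_div_le_one_div_of_le ha0 hab
      have : (b - a) / a - (b - a) / b = (b - a) * (1 / a - 1 / b) := by ring
      rw [this]
      nlinarith
    linarith
  have hanti : Antitone G := antitone_nat_of_succ_le fun N => (key N).1
  have hmono : Monotone fun N : ℕ => G N - 1 / Real.log ((N : ℝ) + 2) :=
    monotone_nat_of_le_succ fun N => by simpa using (key N).2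
  refine ⟨_, tendsto_atTop_ciInf hanti ⟨G 0 - 1 / Real.log ((0 : ℕ) + 2), ?_⟩⟩
  rintro _ ⟨N, rfl⟩
  have h := hmono (Nat.zero_le N)
  have : 0 ≤ 1 / Real.log ((N : ℝ) + 2) := by
    refine one_div_nonneg.2 (Real.log_nonneg ?_)
    have : (0 : ℝ) ≤ N := N.cast_nonneg
    linarith
  simp only at h ⊢
  linarith

/-- Mertens' second theorem, without identification of the constant. -/
theorem exists_tendsto_sum_inv_primesLE_sub_log_log :
    ∃ M : ℝ, Tendsto (fun n : ℕ =>
      ∑ p ∈ Nat.primesLE n, (1 : ℝ) / p - Real.log (Real.log n)) atTop (𝓝 M) := by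
  obtain ⟨C, hC⟩ := abs_sum_log_div_sub_log_le
  obtain ⟨l, hl⟩ := exists_tendsto_sum_log_sub_div_log
  set f : ℕ → ℝ := fun i => 1 / Real.log (i + 2) with hf
  -- The partial sums of `z` are the error in Mertens' first theorem, hence bounded; with `f`
  -- decreasing to zero, Dirichlet's test applies to `∑ f i * z i`.
  set z : ℕ → ℝ := fun i => (if (i + 2).Prime then Real.log ((i + 2 : ℕ) : ℝ) / ((i + 2 : ℕ) : ℝ)
    else 0) - (Real.log (i + 2) - Real.log (i + 1)) with hz
  have hz_sum : ∀ N, ∑ i ∈ range N, z i =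
      ∑ p ∈ Nat.primesLE (N + 1), Real.log p / (p : ℝ) - Real.log ((N + 1 : ℕ) : ℝ) := by
    intro N
    rw [sum_primesLE_succ_eq_sum_range (fun p => Real.log p / (p : ℝ)), hz,
      Finset.sum_sub_distrib]
    congr 1
    have := Finset.sum_range_sub (fun i : ℕ => Real.log ((i : ℝ) + 1)) N
    simp only [Nat.cast_zero, zero_add, Real.log_one, sub_zero] at this
    rw [Nat.cast_add_one, ← this]
    refine Finset.sum_congr rfl fun i _ => ?_
    push_cast
    ring_nf
  have hfa : Antitone f := by
    intro i j hij
    have hi : (0 : ℝ) ≤ i := i.cast_nonneg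
    have hij' : (i : ℝ) ≤ j := by exact_mod_cast hij
    exact one_div_le_one_div_of_le (Real.log_pos (by linarith))
      (Real.log_le_log (by linarith) (by linarith))
  have hf0 : Tendsto f atTop (𝓝 0) := by
    have : Tendsto (fun i : ℕ => Real.log ((i : ℝ) + 2)) atTop atTop :=
      Real.tendsto_log_atTop.comp
        (tendsto_atTop_add_const_right _ _ tendsto_natCast_atTop_atTop)
    exact this.const_div_atTop 1
  have hcau := hfa.cauchySeq_series_mul_of_tendsto_zero_of_bounded (z := z) (b := C) hf0
    (fun N => by rw [hz_sum, Real.norm_eq_abs]; exact hC (N + 1))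
  obtain ⟨L, hL⟩ := cauchySeq_tendsto_of_complete hcau
  refine ⟨L + l, ?_⟩
  rw [← tendsto_add_atTop_iff_nat 2]
  refine ((hL.comp (tendsto_add_atTop_nat 1)).add hl).congr fun N => ?_
  have e : ∀ i : ℕ, f i • z i = (if (i + 2).Prime then (1 : ℝ) / ((i + 2 : ℕ) : ℝ) else 0)
      - (Real.log (i + 2) - Real.log (i + 1)) / Real.log (i + 2) := by
    intro i
    have hi : (0 : ℝ) ≤ i := i.cast_nonneg
    have h0 : Real.log ((i : ℝ) + 2) ≠ 0 := (Real.log_pos (by linarith)).ne'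
    simp only [hf, hz, smul_eq_mul, mul_sub]
    congr 1
    · split_ifs
      · push_cast
        field_simp
      · simp
    · ring
  simp only [Function.comp, e, Finset.sum_sub_distrib]
  rw [← sum_primesLE_succ_eq_sum_range (fun p => (1 : ℝ) / p)]
  push_cast
  ring

/-! ### Laplace transforms -/

/-- A generalized Dirichlet series with nonnegative coefficients is the Laplace transform of its
summatory function. -/
theorem tsum_mul_exp_neg_eq_mul_integral {ι : Type*} [Countable ι] (a l : ι → ℝ)
    (ha : ∀ i, 0 ≤ a i) (hl : ∀ i, 0 ≤ l i) {s : ℝ} (hs : 0 < s)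
    (hsum : Summable fun i => a i * Real.exp (-s * l i)) :
    ∑' i, a i * Real.exp (-s * l i) =
      s * ∫ u in Set.Ioi (0 : ℝ), (∑' i, if l i ≤ u then a i else 0) * Real.exp (-s * u) := by
  -- Each `exp (-s * l i)` is `s` times the integral of `exp (-s * u)` over `u ≥ l i`; nonnegativity
  -- lets sum and integral be exchanged.
  set F : ι → ℝ → ℝ := fun i => (Set.Ici (l i)).indicator fun u => a i * Real.exp (-s * u)
    with hF
  have hint0 : IntegrableOn (fun u => Real.exp (-s * u)) (Set.Ioi 0) :=
    exp_neg_integrableOn_Ioi 0 hs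
  have hint : ∀ i, Integrable (F i) (volume.restrict (Set.Ioi 0)) := fun i =>
    (hint0.integrable.const_mul (a i)).indicator measurableSet_Ici
  have hval : ∀ i, ∫ u in Set.Ioi (0 : ℝ), F i u = s⁻¹ * (a i * Real.exp (-s * l i)) := by
    intro i
    rw [hF]
    simp only
    rw [setIntegral_indicator measurableSet_Ici, integral_const_mul]
    have : ∫ u in Set.Ioi (0 : ℝ) ∩ Set.Ici (l i), Real.exp (-s * u) =
        ∫ u in Set.Ioi (l i), Real.exp (-s * u) := by
      apply setIntegral_congr_set
      have h1 : (Set.Ioi (0 : ℝ) ∩ Set.Ioi (l i) : Set ℝ) =ᵐ[volume]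
          (Set.Ioi (0 : ℝ) ∩ Set.Ici (l i) : Set ℝ) :=
        (ae_eq_refl _).inter Ioi_ae_eq_Ici
      refine h1.symm.trans ?_
      rw [Set.Ioi_inter_Ioi, max_eq_right (hl i)]
      exact EventuallyEq.rfl
    rw [this, integral_exp_mul_Ioi (by linarith)]
    field_simp
  have hnorm : ∀ i u, ‖F i u‖ = F i u := fun i u => by
    rw [Real.norm_eq_abs, abs_of_nonneg]
    exact Set.indicator_nonneg (fun u _ => mul_nonneg (ha i) (Real.exp_pos _).le) u
  have h := hasSum_integral_of_summable_integral_norm hint (by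
    simp only [hnorm, hval]
    exact hsum.mul_left _)
  simp only [hval] at h
  have h' := (h.mul_left s).tsum_eq
  simp only [← mul_assoc, mul_inv_cancel₀ hs.ne', one_mul] at h'
  rw [h']
  congr 1
  refine integral_congr_ae (Eventually.of_forall fun u => ?_)
  simp only [hF]
  rw [← tsum_mul_right]
  refine tsum_congr fun i => ?_
  by_cases hu : l i ≤ u <;> simp [hu]

/-- Abelian theorem for the Laplace transform of a bounded function. -/
theorem tendsto_mul_integral_mul_exp_neg {F : ℝ → ℝ} (hF : Measurable F) {K L : ℝ}
    (hK : ∀ u, 0 < u → |F u| ≤ K) (hL : Tendsto F atTop (𝓝 L)) :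
    Tendsto (fun s : ℝ => s * ∫ u in Set.Ioi (0 : ℝ), F u * Real.exp (-s * u))
      (𝓝[>] 0) (𝓝 L) := by
  -- Substituting `v = s * u` moves `s` into the argument of `F`, so dominated convergence applies.
  have hlim : Tendsto (fun s : ℝ => ∫ v in Set.Ioi (0 : ℝ), F (v / s) * Real.exp (-v))
      (𝓝[>] 0) (𝓝 (∫ v in Set.Ioi (0 : ℝ), L * Real.exp (-v))) := by
    refine tendsto_integral_filter_of_dominated_convergence (fun v => K * Real.exp (-v)) ?_ ?_ ?_ ?_
    · refine Eventually.of_forall fun s => Measurable.aestronglyMeasurable ?_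
      exact (hF.comp (measurable_id.div_const s)).mul (by fun_prop)
    · filter_upwards [self_mem_nhdsWithin] with s hs
      rw [ae_restrict_iff' measurableSet_Ioi]
      refine Eventually.of_forall fun v hv => ?_
      rw [norm_mul, Real.norm_eq_abs, Real.norm_eq_abs, Real.abs_exp]
      gcongr
      exact hK _ (div_pos hv hs)
    · have := exp_neg_integrableOn_Ioi 0 one_pos
      simp only [neg_mul, one_mul] at this
      exact this.integrable.const_mul K
    · rw [ae_restrict_iff' measurableSet_Ioi]
      refine Eventually.of_forall fun v hv => ?_
      refine Tendsto.mul_const _ (hL.comp ?_)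
      exact tendsto_inv_nhdsGT_zero.const_mul_atTop hv
  rw [integral_const_mul, integral_exp_neg_Ioi_zero, mul_one] at hlim
  refine hlim.congr' ?_
  filter_upwards [self_mem_nhdsWithin] with s hs
  have h := integral_comp_mul_left_Ioi (fun v => F (v / s) * Real.exp (-v)) 0 hs
  rw [mul_zero, smul_eq_mul] at h
  have hs0 : s ≠ 0 := (Set.mem_Ioi.1 hs).ne'
  have h2 : ∫ u in Set.Ioi (0 : ℝ), F u * Real.exp (-s * u) =
      s⁻¹ * ∫ v in Set.Ioi (0 : ℝ), F (v / s) * Real.exp (-v) := by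
    rw [← h]
    refine integral_congr_ae (Eventually.of_forall fun u => ?_)
    simp only [mul_div_cancel_left₀ u hs0, neg_mul]
  rw [h2, mul_inv_cancel_left₀ hs0]

/-! ### Prime reciprocals against harmonic numbers -/

theorem tsum_ite_le_one_div_eq_harmonic (u : ℝ) :
    ∑' m : ℕ, (if (m : ℝ) + 1 ≤ u then 1 / ((m : ℝ) + 1) else 0) = (harmonic ⌊u⌋₊ : ℝ) := by
  have hiff : ∀ m : ℕ, (m : ℝ) + 1 ≤ u ↔ m ∈ range ⌊u⌋₊ := fun m => by
    rw [Finset.mem_range, ← Nat.add_one_le_iff, Nat.le_floor_iff' (Nat.succ_ne_zero m)]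
    push_cast
    rfl
  rw [tsum_eq_sum (s := range ⌊u⌋₊) fun m hm => if_neg fun h => hm ((hiff m).1 h), harmonic]
  push_cast
  refine Finset.sum_congr rfl fun m hm => ?_
  rw [if_pos ((hiff m).2 hm), one_div]

theorem neg_log_one_sub_exp_neg_eq_mul_integral {s : ℝ} (hs : 0 < s) :
    -Real.log (1 - Real.exp (-s)) =
      s * ∫ u in Set.Ioi (0 : ℝ), (harmonic ⌊u⌋₊ : ℝ) * Real.exp (-s * u) := by
  have hx : |Real.exp (-s)| < 1 := by
    rw [Real.abs_exp, Real.exp_lt_one_iff]; linarith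
  have h := Real.hasSum_pow_div_log_of_abs_lt_one hx
  have e : ∀ m : ℕ, Real.exp (-s) ^ (m + 1) / ((m : ℝ) + 1) =
      1 / ((m : ℝ) + 1) * Real.exp (-s * ((m : ℝ) + 1)) := fun m => by
    rw [← Real.exp_nat_mul]
    push_cast
    ring_nf
  simp only [e] at h
  rw [← h.tsum_eq, tsum_mul_exp_neg_eq_mul_integral (fun m : ℕ => 1 / ((m : ℝ) + 1))
    (fun m => (m : ℝ) + 1) (fun m => by positivity) (fun m => by positivity) hs h.summable]
  simp only [tsum_ite_le_one_div_eq_harmonic]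

theorem tsum_primes_ite_log_le (u : ℝ) :
    ∑' p : Nat.Primes, (if Real.log (p : ℕ) ≤ u then 1 / ((p : ℕ) : ℝ) else 0) =
      ∑ p ∈ Nat.primesLE ⌊Real.exp u⌋₊, (1 : ℝ) / p := by
  have h := tsum_subtype {p : ℕ | p.Prime}
    (fun n : ℕ => if Real.log (n : ℝ) ≤ u then 1 / (n : ℝ) else 0)
  refine h.trans ?_
  have hiff : ∀ n : ℕ, n.Prime → (Real.log (n : ℝ) ≤ u ↔ n ∈ Nat.primesLE ⌊Real.exp u⌋₊) := by
    intro n hn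
    rw [Nat.mem_primesLE, Nat.le_floor_iff' hn.ne_zero,
      Real.log_le_iff_le_exp (by exact_mod_cast hn.pos)]
    simp [hn]
  rw [tsum_eq_sum (s := Nat.primesLE ⌊Real.exp u⌋₊)]
  · refine Finset.sum_congr rfl fun n hn => ?_
    have hp := Nat.prime_of_mem_primesLE hn
    rw [Set.indicator_of_mem (show n ∈ {p : ℕ | p.Prime} from hp), if_pos ((hiff n hp).2 hn)]
  · intro n hn
    by_cases hp : n.Prime
    · rw [Set.indicator_of_mem (show n ∈ {p : ℕ | p.Prime} from hp),
        if_neg fun h => hn ((hiff n hp).1 h)]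
    · exact Set.indicator_of_notMem (show n ∉ {p : ℕ | p.Prime} from hp) _

theorem tsum_primes_rpow_eq_mul_integral {s : ℝ} (hs : 0 < s) :
    ∑' p : Nat.Primes, ((p : ℕ) : ℝ) ^ (-(1 + s)) =
      s * ∫ u in Set.Ioi (0 : ℝ), (∑ p ∈ Nat.primesLE ⌊Real.exp u⌋₊, (1 : ℝ) / p) *
        Real.exp (-s * u) := by
  have e : ∀ p : Nat.Primes, ((p : ℕ) : ℝ) ^ (-(1 + s)) =
      1 / ((p : ℕ) : ℝ) * Real.exp (-s * Real.log (p : ℕ)) := fun p => by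
    have hp : (0 : ℝ) < (p : ℕ) := by exact_mod_cast p.2.pos
    rw [neg_add, Real.rpow_add hp, Real.rpow_neg_one, Real.rpow_def_of_pos hp, one_div]
    ring_nf
  have hsum : Summable fun p : Nat.Primes => ((p : ℕ) : ℝ) ^ (-(1 + s)) :=
    Nat.Primes.summable_rpow.2 (by linarith)
  simp only [e] at hsum ⊢
  rw [tsum_mul_exp_neg_eq_mul_integral (fun p : Nat.Primes => 1 / ((p : ℕ) : ℝ))
    (fun p => Real.log (p : ℕ)) (fun p => by positivity)
    (fun p => Real.log_natCast_nonneg _) hs hsum]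
  simp only [tsum_primes_ite_log_le]

theorem harmonic_floor_monotone : Monotone fun u : ℝ => (harmonic ⌊u⌋₊ : ℝ) := by
  intro u v huv
  have h : harmonic ⌊u⌋₊ ≤ harmonic ⌊v⌋₊ := by
    refine Finset.sum_le_sum_of_subset_of_nonneg ?_ fun i _ _ => by positivity
    exact Finset.range_subset_range.2 (Nat.floor_mono huv)
  exact Rat.cast_le.2 h

theorem harmonic_floor_nonneg (u : ℝ) : 0 ≤ (harmonic ⌊u⌋₊ : ℝ) := by
  have h : 0 ≤ harmonic ⌊u⌋₊ := Finset.sum_nonneg fun i _ => by positivity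
  exact_mod_cast h

theorem sum_inv_primesLE_floor_exp_monotone :
    Monotone fun u : ℝ => ∑ p ∈ Nat.primesLE ⌊Real.exp u⌋₊, (1 : ℝ) / p := fun _ _ huv =>
  Finset.sum_le_sum_of_subset_of_nonneg
    (Nat.primesLE_mono (Nat.floor_mono (Real.exp_le_exp.2 huv))) fun i _ _ => by positivity

/-- Half of the exponential decay absorbs the growth: `H_⌊u⌋ ≤ u ≤ (2/s) exp (s u / 2)`. -/
theorem integrableOn_harmonic_floor_mul_exp_neg {s : ℝ} (hs : 0 < s) :
    IntegrableOn (fun u : ℝ => (harmonic ⌊u⌋₊ : ℝ) * Real.exp (-s * u)) (Set.Ioi 0) := by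
  have h0 : IntegrableOn (fun u : ℝ => 2 / s * Real.exp (-(s / 2) * u)) (Set.Ioi 0) :=
    (exp_neg_integrableOn_Ioi 0 (half_pos hs)).integrable.const_mul _
  refine Integrable.mono' h0 ?_ ?_
  · exact (harmonic_floor_monotone.measurable.mul (by fun_prop)).aestronglyMeasurable
  · rw [ae_restrict_iff' measurableSet_Ioi]
    refine Eventually.of_forall fun u hu => ?_
    have hu : 0 < u := hu
    rw [norm_mul, Real.norm_eq_abs, Real.norm_eq_abs, Real.abs_exp,
      abs_of_nonneg (harmonic_floor_nonneg u)]
    have h1 : (harmonic ⌊u⌋₊ : ℝ) ≤ u := by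
      have h2 : harmonic ⌊u⌋₊ ≤ (⌊u⌋₊ : ℚ) := by
        refine (Finset.sum_le_card_nsmul _ _ 1 fun i _ => ?_).trans (by simp)
        exact inv_le_one_of_one_le₀ (by exact_mod_cast Nat.succ_le_succ (Nat.zero_le i))
      exact le_trans (by exact_mod_cast h2) (Nat.floor_le hu.le)
    have h3 : u ≤ 2 / s * Real.exp (s / 2 * u) := by
      have := Real.add_one_le_exp (s / 2 * u)
      rw [div_mul_eq_mul_div, le_div_iff₀ hs]
      linarith
    calc (harmonic ⌊u⌋₊ : ℝ) * Real.exp (-s * u)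
        ≤ (2 / s * Real.exp (s / 2 * u)) * Real.exp (-s * u) := by
          gcongr; exact h1.trans h3
      _ = 2 / s * Real.exp (-(s / 2) * u) := by
          rw [mul_assoc, ← Real.exp_add]; ring_nf

theorem tendsto_log_sub_log_floor :
    Tendsto (fun u : ℝ => Real.log u - Real.log (⌊u⌋₊ : ℝ)) atTop (𝓝 0) := by
  have h : Tendsto (fun u : ℝ => Real.log ((⌊u⌋₊ : ℝ) / u)) atTop (𝓝 (Real.log 1)) :=
    (Real.continuousAt_log one_ne_zero).tendsto.comp tendsto_nat_floor_div_atTop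
  rw [Real.log_one] at h
  rw [← neg_zero]
  refine h.neg.congr' ?_
  filter_upwards [eventually_ge_atTop 1] with u hu
  have h1 : (⌊u⌋₊ : ℝ) ≠ 0 := by exact_mod_cast (Nat.floor_pos.2 hu).ne'
  rw [Real.log_div h1 (by linarith), neg_sub]

/-- With `n = ⌊exp u⌋`, `log log n = log u + o(1)`, whereas `H_⌊u⌋ = log u + γ + o(1)`. This is
where `γ` enters. -/
theorem tendsto_sum_inv_primesLE_floor_exp_sub_harmonic {M : ℝ}
    (hM : Tendsto (fun n : ℕ => ∑ p ∈ Nat.primesLE n, (1 : ℝ) / p - Real.log (Real.log n))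
      atTop (𝓝 M)) :
    Tendsto (fun u : ℝ => ∑ p ∈ Nat.primesLE ⌊Real.exp u⌋₊, (1 : ℝ) / p - (harmonic ⌊u⌋₊ : ℝ))
      atTop (𝓝 (M - Real.eulerMascheroniConstant)) := by
  have h1 := hM.comp (tendsto_nat_floor_atTop.comp Real.tendsto_exp_atTop)
  have h2 := Real.tendsto_harmonic_sub_log.comp (tendsto_nat_floor_atTop (α := ℝ))
  have h4 : Tendsto (fun u : ℝ => Real.log (⌊Real.exp u⌋₊ : ℝ) - u) atTop (𝓝 0) := by
    have := (tendsto_log_sub_log_floor.comp Real.tendsto_exp_atTop).neg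
    rw [neg_zero] at this
    refine this.congr fun u => ?_
    simp [Real.log_exp]
  have h5 : Tendsto (fun u : ℝ => Real.log (Real.log (⌊Real.exp u⌋₊ : ℝ)) - Real.log u)
      atTop (𝓝 0) := by
    have h6 : Tendsto (fun u : ℝ => Real.log (⌊Real.exp u⌋₊ : ℝ) / u) atTop (𝓝 1) := by
      have := (h4.div_atTop tendsto_id).add_const 1
      rw [zero_add] at this
      refine this.congr' ?_
      filter_upwards [eventually_gt_atTop 0] with u hu
      simp only [id]
      field_simp
      ring
    have h7 := (Real.continuousAt_log one_ne_zero).tendsto.comp h6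
    rw [Real.log_one] at h7
    refine h7.congr' ?_
    filter_upwards [eventually_gt_atTop 1] with u hu
    have : 1 < ⌊Real.exp u⌋₊ := by
      have h2 : (2 : ℝ) ≤ Real.exp u := by linarith [Real.add_one_le_exp u]
      exact Nat.le_floor (by exact_mod_cast h2)
    have h0 : Real.log (⌊Real.exp u⌋₊ : ℝ) ≠ 0 :=
      (Real.log_pos (by exact_mod_cast this)).ne'
    simp only [Function.comp]
    rw [Real.log_div h0 (by linarith)]
  have := ((h1.sub h2).add h5).add tendsto_log_sub_log_floor
  rw [add_zero, add_zero] at this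
  refine this.congr fun u => ?_
  simp only [Function.comp]
  ring

/-- Past some `U` convergence gives the bound; before `U` both functions lie between zero and their
values at `U`. -/
theorem exists_bound_of_tendsto_sub_of_monotone {A B : ℝ → ℝ} {L : ℝ} (hA : Monotone A)
    (hB : Monotone B) (hA0 : ∀ u, 0 ≤ A u) (hB0 : ∀ u, 0 ≤ B u)
    (h : Tendsto (fun u => A u - B u) atTop (𝓝 L)) : ∃ K, ∀ u, |A u - B u| ≤ K := by
  have h1 := h.abs.eventually (gt_mem_nhds (lt_add_one |L|))
  obtain ⟨U, hU⟩ := eventually_atTop.1 h1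
  refine ⟨max (|L| + 1) (A U + B U), fun u => ?_⟩
  rcases le_total U u with hu | hu
  · exact le_max_of_le_left (hU u hu).le
  · refine le_max_of_le_right (abs_le.2 ⟨?_, ?_⟩)
    · linarith [hA0 u, hA0 U, hB hu]
    · linarith [hB0 u, hB0 U, hA hu]

/-- The Abelian theorem handles the difference of the two transforms, and the harmonic one is `-log
(1 - exp (-s)) = -log s + o(1)`. -/
theorem tendsto_tsum_primes_rpow_add_log {M : ℝ}
    (hM : Tendsto (fun n : ℕ => ∑ p ∈ Nat.primesLE n, (1 : ℝ) / p - Real.log (Real.log n))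
      atTop (𝓝 M)) :
    Tendsto (fun s : ℝ => ∑' p : Nat.Primes, ((p : ℕ) : ℝ) ^ (-(1 + s)) + Real.log s) (𝓝[>] 0)
      (𝓝 (M - Real.eulerMascheroniConstant)) := by
  set A : ℝ → ℝ := fun u => ∑ p ∈ Nat.primesLE ⌊Real.exp u⌋₊, (1 : ℝ) / p with hA
  set B : ℝ → ℝ := fun u => (harmonic ⌊u⌋₊ : ℝ) with hB
  have hlim : Tendsto (fun u => A u - B u) atTop (𝓝 (M - Real.eulerMascheroniConstant)) :=
    tendsto_sum_inv_primesLE_floor_exp_sub_harmonic hM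
  have hAm : Monotone A := sum_inv_primesLE_floor_exp_monotone
  have hBm : Monotone B := harmonic_floor_monotone
  obtain ⟨K, hK⟩ := exists_bound_of_tendsto_sub_of_monotone hAm hBm
    (fun u => Finset.sum_nonneg fun i _ => by positivity) harmonic_floor_nonneg hlim
  have hFm : Measurable fun u => A u - B u := hAm.measurable.sub hBm.measurable
  have hab := tendsto_mul_integral_mul_exp_neg hFm (fun u _ => hK u) hlim
  have hexp : Tendsto (fun s : ℝ => Real.log ((1 - Real.exp (-s)) / s)) (𝓝[>] 0) (𝓝 0) := by
    have hd : HasDerivAt (fun s : ℝ => 1 - Real.exp (-s)) 1 0 := by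
      have := ((hasDerivAt_id (0 : ℝ)).neg.exp).const_sub 1
      simpa using this
    have h1 := (hasDerivAt_iff_tendsto_slope.1 hd).mono_left
      (nhdsWithin_mono 0 fun x (hx : 0 < x) => hx.ne')
    have h2 := (Real.continuousAt_log one_ne_zero).tendsto.comp h1
    rw [Real.log_one] at h2
    refine h2.congr fun s => ?_
    simp [slope_def_field]
  have := hab.sub hexp
  rw [sub_zero] at this
  refine this.congr' ?_
  filter_upwards [self_mem_nhdsWithin] with s hs
  have hs : 0 < s := hs
  have hBi : IntegrableOn (fun u => B u * Real.exp (-s * u)) (Set.Ioi 0) :=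
    integrableOn_harmonic_floor_mul_exp_neg hs
  have hFi : IntegrableOn (fun u => (A u - B u) * Real.exp (-s * u)) (Set.Ioi 0) := by
    refine Integrable.mono' ((exp_neg_integrableOn_Ioi 0 hs).integrable.const_mul K)
      (hFm.mul (by fun_prop)).aestronglyMeasurable (Eventually.of_forall fun u => ?_)
    rw [norm_mul, Real.norm_eq_abs, Real.norm_eq_abs, Real.abs_exp]
    gcongr
    exact hK u
  have hsplit : ∫ u in Set.Ioi (0 : ℝ), A u * Real.exp (-s * u) =
      (∫ u in Set.Ioi (0 : ℝ), (A u - B u) * Real.exp (-s * u)) +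
        ∫ u in Set.Ioi (0 : ℝ), B u * Real.exp (-s * u) := by
    rw [← integral_add hFi hBi]
    refine integral_congr_ae (Eventually.of_forall fun u => ?_)
    simp only
    ring
  have hexp1 : Real.exp (-s) < 1 := by rw [Real.exp_lt_one_iff]; linarith
  rw [tsum_primes_rpow_eq_mul_integral hs, Real.log_div (by linarith) hs.ne']
  have h1 := neg_log_one_sub_exp_neg_eq_mul_integral hs
  change _ = s * ∫ u in Set.Ioi (0 : ℝ), B u * Real.exp (-s * u) at h1
  change _ = s * (∫ u in Set.Ioi (0 : ℝ), A u * Real.exp (-s * u)) + _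
  rw [hsplit, mul_add, ← h1]
  ring

/-! ### The Euler product and Mertens' third theorem -/

theorem neg_log_one_sub_sub_nonneg {x : ℝ} (hx1 : x < 1) :
    0 ≤ -Real.log (1 - x) - x := by
  have := Real.log_le_sub_one_of_pos (sub_pos.2 hx1)
  linarith

theorem neg_log_one_sub_sub_le {x : ℝ} (hx : x ≤ 1 / 2) :
    -Real.log (1 - x) - x ≤ 2 * x ^ 2 := by
  have h0 : 0 < 1 - x := by linarith
  have := Real.log_le_sub_one_of_pos (inv_pos.2 h0)
  rw [Real.log_inv] at this
  have e : (1 - x)⁻¹ - 1 - x = x ^ 2 / (1 - x) := by field_simp; ring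
  have h2 : x ^ 2 / (1 - x) ≤ 2 * x ^ 2 := by
    rw [div_le_iff₀ h0]
    nlinarith [sq_nonneg x]
  linarith

theorem prime_rpow_neg_le_inv (p : Nat.Primes) {s : ℝ} (hs : 0 ≤ s) :
    ((p : ℕ) : ℝ) ^ (-(1 + s)) ≤ ((p : ℕ) : ℝ)⁻¹ := by
  rw [← Real.rpow_neg_one]
  exact Real.rpow_le_rpow_of_exponent_le (by exact_mod_cast p.2.one_le) (by linarith)

theorem prime_inv_le_half (p : Nat.Primes) : ((p : ℕ) : ℝ)⁻¹ ≤ 1 / 2 := by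
  rw [one_div]
  exact inv_anti₀ two_pos (by exact_mod_cast p.2.two_le)

/-- The bound is uniform in `s ≥ 0`, so it dominates the sum as `s → 0+` and gives convergence at `s
= 0` itself. -/
theorem norm_neg_log_one_sub_prime_rpow_sub_le (p : Nat.Primes) {s : ℝ} (hs : 0 ≤ s) :
    ‖-Real.log (1 - ((p : ℕ) : ℝ) ^ (-(1 + s))) - ((p : ℕ) : ℝ) ^ (-(1 + s))‖ ≤
      2 * ((p : ℕ) : ℝ) ^ (-2 : ℝ) := by
  have h1 := prime_rpow_neg_le_inv p hs
  have h2 := prime_inv_le_half p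
  rw [Real.norm_eq_abs, abs_of_nonneg (neg_log_one_sub_sub_nonneg (by linarith))]
  refine (neg_log_one_sub_sub_le (h1.trans h2)).trans ?_
  have : ((p : ℕ) : ℝ) ^ (-2 : ℝ) = (((p : ℕ) : ℝ)⁻¹) ^ 2 := by
    rw [Real.rpow_neg (by positivity), inv_pow]
    norm_cast
  rw [this]
  gcongr

theorem summable_two_mul_prime_rpow_neg_two :
    Summable fun p : Nat.Primes => 2 * ((p : ℕ) : ℝ) ^ (-2 : ℝ) :=
  (Nat.Primes.summable_rpow.2 (by norm_num)).mul_left 2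

theorem summable_neg_log_one_sub_prime_rpow_sub {s : ℝ} (hs : 0 ≤ s) :
    Summable fun p : Nat.Primes =>
      -Real.log (1 - ((p : ℕ) : ℝ) ^ (-(1 + s))) - ((p : ℕ) : ℝ) ^ (-(1 + s)) :=
  Summable.of_norm_bounded summable_two_mul_prime_rpow_neg_two
    fun p => norm_neg_log_one_sub_prime_rpow_sub_le p hs

theorem tendsto_tsum_neg_log_one_sub_prime_rpow_sub :
    Tendsto (fun s : ℝ => ∑' p : Nat.Primes,
      (-Real.log (1 - ((p : ℕ) : ℝ) ^ (-(1 + s))) - ((p : ℕ) : ℝ) ^ (-(1 + s)))) (𝓝[>] 0)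
      (𝓝 (∑' p : Nat.Primes,
        (-Real.log (1 - ((p : ℕ) : ℝ) ^ (-(1 + (0 : ℝ)))) -
          ((p : ℕ) : ℝ) ^ (-(1 + (0 : ℝ)))))) := by
  refine tendsto_tsum_of_dominated_convergence summable_two_mul_prime_rpow_neg_two
    (fun p => ?_) ?_
  · have hp : ((p : ℕ) : ℝ) ≠ 0 := by exact_mod_cast p.2.ne_zero
    have hc : ContinuousAt (fun s : ℝ => ((p : ℕ) : ℝ) ^ (-(1 + s))) 0 :=
      ContinuousAt.rpow continuousAt_const (by fun_prop) (Or.inl hp)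
    have hne : 1 - ((p : ℕ) : ℝ) ^ (-(1 + (0 : ℝ))) ≠ 0 := by
      have h1 := prime_rpow_neg_le_inv p le_rfl
      have h2 := prime_inv_le_half p
      exact (sub_pos.2 ((h1.trans h2).trans_lt (by norm_num))).ne'
    have h : ContinuousAt (fun s : ℝ => -Real.log (1 - ((p : ℕ) : ℝ) ^ (-(1 + s))) -
        ((p : ℕ) : ℝ) ^ (-(1 + s))) 0 :=
      (((continuousAt_const.sub hc).log hne).neg).sub hc
    exact h.tendsto.mono_left nhdsWithin_le_nhds
  · filter_upwards [self_mem_nhdsWithin] with s hs p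
    exact norm_neg_log_one_sub_prime_rpow_sub_le p (le_of_lt hs)

/-- Splits the logarithm of the Euler product into the part that diverges as `s → 0+` and a
remainder that still converges at `s = 0`. -/
theorem log_riemannZeta_re_eq_tsum {s : ℝ} (hs : 0 < s) :
    Real.log (riemannZeta ((1 + s : ℝ) : ℂ)).re =
      ∑' p : Nat.Primes, ((p : ℕ) : ℝ) ^ (-(1 + s)) +
      ∑' p : Nat.Primes,
        (-Real.log (1 - ((p : ℕ) : ℝ) ^ (-(1 + s))) - ((p : ℕ) : ℝ) ^ (-(1 + s))) := by
  have hsum : Summable fun p : Nat.Primes => ((p : ℕ) : ℝ) ^ (-(1 + s)) :=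
    Nat.Primes.summable_rpow.2 (by linarith)
  rw [← hsum.tsum_add (summable_neg_log_one_sub_prime_rpow_sub hs.le),
    ← riemannZeta_eulerProduct_exp_log (s := ((1 + s : ℝ) : ℂ)) (by simpa using hs)]
  have e : ∀ p : Nat.Primes, -Complex.log (1 - ((p : ℕ) : ℂ) ^ (-((1 + s : ℝ) : ℂ))) =
      ((-Real.log (1 - ((p : ℕ) : ℝ) ^ (-(1 + s))) : ℝ) : ℂ) := fun p => by
    have h1 := prime_rpow_neg_le_inv p hs.le
    have h2 := prime_inv_le_half p
    rw [Complex.ofReal_neg, Complex.ofReal_log (by linarith), Complex.ofReal_sub,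
      Complex.ofReal_one, Complex.ofReal_cpow (by positivity), Complex.ofReal_neg,
      Complex.ofReal_natCast]
  simp only [e]
  rw [← Complex.ofReal_tsum, ← Complex.ofReal_exp, Complex.ofReal_re, Real.log_exp]
  exact tsum_congr fun p => by ring

theorem tendsto_log_riemannZeta_add_log :
    Tendsto (fun s : ℝ => Real.log (riemannZeta ((1 + s : ℝ) : ℂ)).re + Real.log s)
      (𝓝[>] 0) (𝓝 0) := by
  have h := (Asymptotics.isLittleO_one_iff ℝ).1 log_riemannZeta_add_log_sub_isLittleO_ofReal
  have ht : Tendsto (fun s : ℝ => 1 + s) (𝓝[>] 0) (𝓝[>] 1) := by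
    refine tendsto_nhdsWithin_iff.2 ⟨?_, ?_⟩
    · have : Tendsto (fun s : ℝ => 1 + s) (𝓝 0) (𝓝 (1 + 0)) :=
        (continuous_const.add continuous_id).tendsto 0
      rw [add_zero] at this
      exact this.mono_left nhdsWithin_le_nhds
    · filter_upwards [self_mem_nhdsWithin] with s hs
      simpa using hs
  refine (h.comp ht).congr fun s => ?_
  simp

theorem tendsto_sum_neg_log_one_sub_inv_sub_inv :
    Tendsto (fun n : ℕ => ∑ p ∈ Nat.primesLE n, (-Real.log (1 - (p : ℝ)⁻¹) - (p : ℝ)⁻¹)) atTop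
      (𝓝 (∑' p : Nat.Primes,
        (-Real.log (1 - ((p : ℕ) : ℝ) ^ (-(1 + (0 : ℝ)))) -
          ((p : ℕ) : ℝ) ^ (-(1 + (0 : ℝ)))))) := by
  have h := (summable_neg_log_one_sub_prime_rpow_sub le_rfl).hasSum
  have h' := (hasSum_subtype_iff_indicator (s := {p : ℕ | p.Prime})
    (f := fun n : ℕ => -Real.log (1 - (n : ℝ) ^ (-(1 + (0 : ℝ)))) -
      (n : ℝ) ^ (-(1 + (0 : ℝ))))).1 h
  refine (h'.tendsto_sum_nat.comp (tendsto_add_atTop_nat 1)).congr fun n => ?_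
  simp only [Function.comp, Nat.primesLE_eq_filter_range, Finset.sum_filter, Set.indicator_apply,
    Set.mem_ofPred_eq, add_zero, Real.rpow_neg_one]

/-- Mertens' third theorem in logarithmic form. -/
theorem tendsto_sum_log_one_sub_inv_add_log_log :
    Tendsto (fun n : ℕ => ∑ p ∈ Nat.primesLE n, Real.log (1 - (p : ℝ)⁻¹) +
      Real.log (Real.log n)) atTop (𝓝 (-Real.eulerMascheroniConstant)) := by
  obtain ⟨M, hM⟩ := exists_tendsto_sum_inv_primesLE_sub_log_log
  have h1 := tendsto_tsum_primes_rpow_add_log hM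
  have h2 : Tendsto (fun s : ℝ => ∑' p : Nat.Primes, ((p : ℕ) : ℝ) ^ (-(1 + s)) + Real.log s)
      (𝓝[>] 0) _ :=
    (tendsto_log_riemannZeta_add_log.sub tendsto_tsum_neg_log_one_sub_prime_rpow_sub).congr' (by
      filter_upwards [self_mem_nhdsWithin] with s hs
      rw [log_riemannZeta_re_eq_tsum hs]
      ring)
  -- Both evaluations of one limit agree, so `M` plus the remainder sum at `s = 0` equals `γ`.
  have hL := tendsto_nhds_unique h1 h2
  have h3 := (tendsto_sum_neg_log_one_sub_inv_sub_inv.add hM).neg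
  have e : -Real.eulerMascheroniConstant = -((∑' p : Nat.Primes,
        (-Real.log (1 - ((p : ℕ) : ℝ) ^ (-(1 + (0 : ℝ)))) -
          ((p : ℕ) : ℝ) ^ (-(1 + (0 : ℝ))))) + M) := by linarith
  rw [e]
  refine h3.congr fun n => ?_
  rw [Finset.sum_sub_distrib, Finset.sum_neg_distrib]
  simp only [one_div]
  ring

/-- Mertens' third theorem. -/
theorem tendsto_prod_one_sub_inv_mul_log :
    Tendsto (fun n : ℕ => (∏ p ∈ Nat.primesLE n, (1 - (p : ℝ)⁻¹)) * Real.log n) atTop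
      (𝓝 (Real.exp (-Real.eulerMascheroniConstant))) := by
  refine ((Real.continuous_exp.tendsto _).comp
    tendsto_sum_log_one_sub_inv_add_log_log).congr' ?_
  filter_upwards [eventually_ge_atTop 2] with n hn
  simp only [Function.comp]
  rw [Real.exp_add, Real.exp_log (Real.log_pos (by exact_mod_cast hn)), Real.exp_sum]
  congr 1
  refine Finset.prod_congr rfl fun p hp => Real.exp_log (sub_pos.2 ?_)
  exact inv_lt_one_of_one_lt₀ (by exact_mod_cast Nat.one_lt_of_mem_primesLE hp)

/-! ### The lower bound for the totient -/

theorem totient_div_eq_prod {n : ℕ} (hn : n ≠ 0) :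
    (Nat.totient n : ℝ) / n = ∏ p ∈ n.primeFactors, (1 - (p : ℝ)⁻¹) := by
  have h := congrArg (fun q : ℚ => (q : ℝ)) (Nat.totient_eq_mul_prod_factors n)
  push_cast at h
  rw [h, mul_div_cancel_left₀ _ (by exact_mod_cast hn)]

theorem one_sub_inv_prime_mem {p : ℕ} (hp : p.Prime) :
    0 ≤ 1 - (p : ℝ)⁻¹ ∧ 1 - (p : ℝ)⁻¹ ≤ 1 := by
  have h1 : (p : ℝ)⁻¹ ≤ 1 := inv_le_one_of_one_le₀ (by exact_mod_cast hp.one_le)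
  have h2 : 0 ≤ (p : ℝ)⁻¹ := by positivity
  constructor <;> linarith

/-- The prime divisors of `n` exceeding `log n` contribute a factor close to one. -/
theorem prod_mul_one_sub_le_totient_div {n : ℕ} (hn : 1 < Real.log (Real.log n)) :
    (∏ p ∈ Nat.primesLE ⌊Real.log n⌋₊, (1 - (p : ℝ)⁻¹)) * (1 - 1 / Real.log (Real.log n)) ≤
      (Nat.totient n : ℝ) / n := by
  have hn0 : n ≠ 0 := by
    rintro rfl
    norm_num at hn
  set y := Real.log n with hy
  have hy0 : 0 ≤ y := Real.log_natCast_nonneg n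
  have hy1 : 1 < y := by
    by_contra h
    have := Real.log_nonpos hy0 (not_lt.1 h)
    linarith
  have hly : 0 < Real.log y := by linarith
  set S := n.primeFactors.filter (· ≤ ⌊y⌋₊) with hS
  set T := n.primeFactors.filter (¬ · ≤ ⌊y⌋₊) with hT
  have hTmem : ∀ p ∈ T, y ≤ (p : ℝ) := fun p hp => by
    have := (Finset.mem_filter.1 hp).2
    exact (Nat.lt_of_floor_lt (not_le.1 this)).le
  have hsmall : ∏ p ∈ Nat.primesLE ⌊y⌋₊, (1 - (p : ℝ)⁻¹) ≤ ∏ p ∈ S, (1 - (p : ℝ)⁻¹) := by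
    have hsub : S ⊆ Nat.primesLE ⌊y⌋₊ := fun p hp => by
      rw [hS, Finset.mem_filter] at hp
      exact Nat.mem_primesLE.2 ⟨hp.2, Nat.prime_of_mem_primeFactors hp.1⟩
    have hmem := fun p (hp : p ∈ Nat.primesLE ⌊y⌋₊) =>
      one_sub_inv_prime_mem (Nat.prime_of_mem_primesLE hp)
    exact Finset.prod_le_prod_of_subset_of_le_one hsub (fun p hp => (hmem p hp).1)
      fun p hp _ => (hmem p hp).2
  -- The primes in `T` are at least `y` and their product divides `n = exp y`.
  have hcard : (T.card : ℝ) * Real.log y ≤ y := by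
    have h1 : y ^ T.card ≤ (n : ℝ) := by
      calc y ^ T.card = ∏ p ∈ T, y := by rw [Finset.prod_const]
        _ ≤ ∏ p ∈ T, (p : ℝ) := Finset.prod_le_prod (fun _ _ => hy0) hTmem
        _ = ((∏ p ∈ T, p : ℕ) : ℝ) := by push_cast; rfl
        _ ≤ n := by
          have h2 : ∏ p ∈ T, p ∣ n :=
            (Finset.prod_dvd_prod_of_subset _ _ _ (Finset.filter_subset _ _)).trans
              (Nat.prod_primeFactors_dvd n)
          exact_mod_cast Nat.le_of_dvd (Nat.pos_of_ne_zero hn0) h2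
    rw [← Real.log_pow]
    exact Real.log_le_log (by positivity) h1
  have hlarge : 1 - 1 / Real.log y ≤ ∏ p ∈ T, (1 - (p : ℝ)⁻¹) := by
    have hyinv : y⁻¹ ≤ 1 := inv_le_one_of_one_le₀ hy1.le
    calc 1 - 1 / Real.log y ≤ 1 + T.card * (-y⁻¹) := by
          have : (T.card : ℝ) * y⁻¹ ≤ 1 / Real.log y := by
            rw [le_div_iff₀ hly, ← div_eq_mul_inv, div_mul_eq_mul_div,
              div_le_one (by linarith)]
            exact hcard
          linarith
      _ ≤ (1 + -y⁻¹) ^ T.card := one_add_mul_le_pow (by linarith) _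
      _ = ∏ p ∈ T, (1 - y⁻¹) := by rw [Finset.prod_const, sub_eq_add_neg]
      _ ≤ _ := by
          refine Finset.prod_le_prod (fun _ _ => by linarith) fun p hp => ?_
          have := inv_anti₀ (by linarith) (hTmem p hp)
          linarith
  rw [totient_div_eq_prod hn0, ← Finset.prod_filter_mul_prod_filter_not n.primeFactors (· ≤ ⌊y⌋₊)]
  have h1 : 1 / Real.log y ≤ 1 := by rw [div_le_one hly]; exact hn.le
  refine mul_le_mul hsmall hlarge (by linarith) (Finset.prod_nonneg fun p hp => ?_)
  exact (one_sub_inv_prime_mem (Nat.prime_of_mem_primeFactors (Finset.mem_filter.1 hp).1)).1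

theorem tendsto_log_natCast_atTop : Tendsto (fun n : ℕ => Real.log (n : ℝ)) atTop atTop :=
  Real.tendsto_log_atTop.comp tendsto_natCast_atTop_atTop

theorem tendsto_log_log_natCast_atTop :
    Tendsto (fun n : ℕ => Real.log (Real.log (n : ℝ))) atTop atTop :=
  Real.tendsto_log_atTop.comp tendsto_log_natCast_atTop

theorem exists_tendsto_le_totient_mul_log_log_div :
    ∃ g : ℕ → ℝ, Tendsto g atTop (𝓝 (Real.exp (-Real.eulerMascheroniConstant))) ∧
      ∀ᶠ n in atTop, g n ≤ (Nat.totient n : ℝ) * Real.log (Real.log n) / n := by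
  -- Taking the floor in the logarithm too only lowers the bound, and makes Mertens' theorem apply
  -- at the integer `⌊log n⌋`.
  refine ⟨fun n => ((∏ p ∈ Nat.primesLE ⌊Real.log n⌋₊, (1 - (p : ℝ)⁻¹)) *
    Real.log (⌊Real.log n⌋₊ : ℝ)) * (1 - 1 / Real.log (Real.log n)), ?_, ?_⟩
  · have h1 := tendsto_prod_one_sub_inv_mul_log.comp
      ((tendsto_nat_floor_atTop (α := ℝ)).comp tendsto_log_natCast_atTop)
    have h2 := (tendsto_log_log_natCast_atTop.const_div_atTop 1).const_sub 1
    have := h1.mul h2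
    rw [sub_zero, mul_one] at this
    exact this
  · filter_upwards [tendsto_log_log_natCast_atTop.eventually_gt_atTop 1,
      tendsto_log_natCast_atTop.eventually_ge_atTop 1] with n hn hn1
    have h := prod_mul_one_sub_le_totient_div hn
    set y := Real.log (n : ℝ) with hy
    have hfl : Real.log (⌊y⌋₊ : ℝ) ≤ Real.log y :=
      Real.log_le_log (by exact_mod_cast Nat.floor_pos.2 hn1) (Nat.floor_le (by linarith))
    have h0 : 0 ≤ ∏ p ∈ Nat.primesLE ⌊y⌋₊, (1 - (p : ℝ)⁻¹) := Finset.prod_nonneg fun p hp =>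
      (one_sub_inv_prime_mem (Nat.prime_of_mem_primesLE hp)).1
    have h1 : 0 ≤ 1 - 1 / Real.log y := by
      rw [sub_nonneg, div_le_one (by linarith)]; exact hn.le
    calc _ ≤ ((∏ p ∈ Nat.primesLE ⌊y⌋₊, (1 - (p : ℝ)⁻¹)) * Real.log y) *
          (1 - 1 / Real.log y) := by gcongr
      _ = ((∏ p ∈ Nat.primesLE ⌊y⌋₊, (1 - (p : ℝ)⁻¹)) * (1 - 1 / Real.log y)) *
          Real.log y := by ring
      _ ≤ ((Nat.totient n : ℝ) / n) * Real.log y := by gcongr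
      _ = _ := by ring

/-! ### Regular integers modulo powers of primorials -/

theorem isRegularMod_of_coprime {n a : ℕ} (h : a.Coprime n) : IsRegularMod n (a : ℤ) := by
  obtain ⟨x, hx⟩ := Int.mod_coprime h
  refine ⟨x, ?_⟩
  have := hx.mul_left (a : ℤ)
  rwa [mul_one, ← mul_assoc, ← sq] at this

theorem totient_le_regularCount (n : ℕ) : Nat.totient n ≤ regularCount n := by
  classical
  rw [← Nat.filter_coprime_Ico_eq_totient n 1, regularCount]
  refine Finset.card_le_card fun a ha => ?_
  rw [Finset.mem_filter, Finset.mem_Ico] at ha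
  rw [regularIntegers, Finset.mem_filter, Finset.mem_Icc]
  exact ⟨⟨ha.1.1, by omega⟩, isRegularMod_of_coprime ha.2.symm⟩

/-- `p^k` divides `a (a x - 1)`, and the second factor is coprime to `p` because `p ∣ a`. -/
theorem pow_dvd_of_isRegularMod {n a p k : ℕ} (hpa : p ∣ a) (hpn : p ^ k ∣ n)
    (h : IsRegularMod n (a : ℤ)) : p ^ k ∣ a := by
  obtain ⟨x, hx⟩ := h
  have h1 : ((p : ℤ) ^ k) ∣ (a : ℤ) * (a * x - 1) := by
    have h2 : (n : ℤ) ∣ (a : ℤ) ^ 2 * x - a := (Int.modEq_iff_dvd.1 hx.symm)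
    have h3 : ((p : ℤ) ^ k) ∣ (n : ℤ) := by exact_mod_cast hpn
    refine (h3.trans h2).trans (dvd_of_eq (by ring))
  have hcop : IsCoprime ((p : ℤ) ^ k) (a * x - 1) := by
    refine IsCoprime.pow_left ?_
    obtain ⟨c, hc⟩ := hpa
    exact ⟨c * x, -1, by rw [hc]; push_cast; ring⟩
  exact_mod_cast hcop.dvd_of_dvd_mul_right h1

theorem regularCount_primorial_pow_le (m : ℕ) {k : ℕ} :
    regularCount (primorial m ^ k) ≤ Nat.totient (primorial m ^ k) +
      ∑ p ∈ Nat.primesLE m, primorial m ^ k / p ^ k := by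
  classical
  set n := primorial m ^ k with hn
  have hcov : regularIntegers n ⊆ (Finset.Ico 1 (1 + n)).filter n.Coprime ∪
      (Nat.primesLE m).biUnion fun p => (Finset.Ioc 0 n).filter (p ^ k ∣ ·) := by
    intro a ha
    rw [regularIntegers, Finset.mem_filter, Finset.mem_Icc] at ha
    rw [Finset.mem_union, Finset.mem_filter, Finset.mem_Ico]
    by_cases hc : n.Coprime a
    · exact Or.inl ⟨⟨ha.1.1, by omega⟩, hc⟩
    · right
      obtain ⟨p, hp, hpn, hpa⟩ := Nat.Prime.not_coprime_iff_dvd.1 hc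
      have hpm : p ∣ primorial m := hp.dvd_of_dvd_pow hpn
      rw [Finset.mem_biUnion]
      refine ⟨p, Nat.mem_primesLE.2 ⟨hp.dvd_primorial_iff.1 hpm, hp⟩, ?_⟩
      rw [Finset.mem_filter, Finset.mem_Ioc]
      exact ⟨⟨ha.1.1, ha.1.2⟩, pow_dvd_of_isRegularMod hpa (pow_dvd_pow_of_dvd hpm k) ha.2⟩
  calc regularCount n ≤ _ := Finset.card_le_card hcov
    _ ≤ _ := Finset.card_union_le _ _
    _ ≤ _ := by
      rw [Nat.filter_coprime_Ico_eq_totient]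
      gcongr
      refine Finset.card_biUnion_le.trans (le_of_eq ?_)
      simp only [Nat.Ioc_filter_dvd_card_eq_div]

/-- Each of the at most `m` primes contributes at most `n / p^k ≤ n / m^2` regular non-units. -/
theorem regularCount_primorial_pow_div_le {m k : ℕ} (hm : m ≠ 0) (hk : k ≠ 0)
    (hmk : m ^ 2 ≤ 2 ^ k) :
    (regularCount (primorial m ^ k) : ℝ) / (primorial m ^ k : ℕ) ≤
      ∏ p ∈ Nat.primesLE m, (1 - (p : ℝ)⁻¹) + 1 / m := by
  set n := primorial m ^ k with hn
  have hn0 : n ≠ 0 := pow_ne_zero _ (primorial_ne_zero m)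
  have hn0' : (0 : ℝ) < n := by exact_mod_cast Nat.pos_of_ne_zero hn0
  have hm0 : (0 : ℝ) < m := by exact_mod_cast Nat.pos_of_ne_zero hm
  have hphi : (Nat.totient n : ℝ) / n = ∏ p ∈ Nat.primesLE m, (1 - (p : ℝ)⁻¹) := by
    rw [totient_div_eq_prod hn0, hn, Nat.primeFactors_pow _ hk, primeFactors_primorial]
  have h1 : (regularCount n : ℝ) ≤ Nat.totient n +
      ∑ p ∈ Nat.primesLE m, ((n / p ^ k : ℕ) : ℝ) := by
    exact_mod_cast regularCount_primorial_pow_le m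
  have h2 : ∑ p ∈ Nat.primesLE m, ((n / p ^ k : ℕ) : ℝ) ≤ n * (1 / m) := by
    calc ∑ p ∈ Nat.primesLE m, ((n / p ^ k : ℕ) : ℝ)
        ≤ ∑ p ∈ Nat.primesLE m, (n : ℝ) / m ^ 2 := by
          refine Finset.sum_le_sum fun p hp => Nat.cast_div_le.trans ?_
          have h3 : m ^ 2 ≤ p ^ k :=
            hmk.trans (Nat.pow_le_pow_left (Nat.two_le_of_mem_primesLE hp) k)
          have h4 : (m : ℝ) ^ 2 ≤ ((p ^ k : ℕ) : ℝ) := by exact_mod_cast h3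
          gcongr
      _ = (Nat.primesLE m).card * ((n : ℝ) / m ^ 2) := by rw [Finset.sum_const, nsmul_eq_mul]
      _ ≤ m * ((n : ℝ) / m ^ 2) := by
          gcongr
          rw [Nat.primesLE_eq_filter_Icc_one]
          exact (Finset.card_filter_le _ _).trans (by simp)
      _ = _ := by field_simp
  calc (regularCount n : ℝ) / n ≤ (Nat.totient n + n * (1 / m)) / n := by
        gcongr; linarith
    _ = Nat.totient n / n + 1 / m := by field_simp
    _ = _ := by rw [hphi]

/-- `log (m#) ≤ m log 4 ≤ 2m`, so `k log (m#) ≤ 12 m log m`. -/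
theorem log_log_primorial_pow_le {m k : ℕ} (hm : 3 ≤ m) (hk : k ≠ 0)
    (hkm : (k : ℝ) ≤ 6 * Real.log m) :
    Real.log (Real.log ((primorial m ^ k : ℕ) : ℝ)) ≤
      Real.log m + (Real.log 12 + Real.log (Real.log m)) := by
  have hm0 : (0 : ℝ) < m := by exact_mod_cast (by omega : 0 < m)
  have hlm : 0 < Real.log m := Real.log_pos (by exact_mod_cast (by omega : 1 < m))
  have hprim : (1 : ℝ) < primorial m := by
    have : m ≤ primorial m := le_primorial_self
    exact_mod_cast (by omega : 1 < primorial m)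
  have hk0 : (0 : ℝ) < k := by exact_mod_cast Nat.pos_of_ne_zero hk
  have h4 : Real.log (primorial m) ≤ m * 2 := by
    have h1 : Real.log (primorial m) ≤ Real.log ((4 : ℝ) ^ m) :=
      Real.log_le_log (by linarith) (by exact_mod_cast primorial_le_four_pow m)
    rw [Real.log_pow] at h1
    have h2 : Real.log 4 ≤ 2 := by
      have : Real.log 4 = 2 * Real.log 2 := by
        rw [show (4 : ℝ) = 2 ^ 2 by norm_num, Real.log_pow]; norm_num
      linarith [Real.log_two_lt_d9]
    nlinarith
  push_cast
  rw [Real.log_pow, ← Real.log_mul (by norm_num) hlm.ne', ← Real.log_mul hm0.ne' (by positivity)]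
  refine Real.log_le_log (mul_pos hk0 (Real.log_pos hprim)) ?_
  have h0 := (Real.log_pos hprim).le
  calc (k : ℝ) * Real.log (primorial m) ≤ (6 * Real.log m) * (m * 2) := by gcongr
    _ = _ := by ring

theorem tendsto_primorial_pow_log_atTop :
    Tendsto (fun m : ℕ => primorial m ^ (2 * (Nat.log 2 m + 1))) atTop atTop := by
  refine tendsto_atTop_mono (fun m => ?_) tendsto_id
  exact (le_primorial_self (n := m)).trans (Nat.le_self_pow (by omega) _)

/-- The exponent `k = 2 (⌊log₂ m⌋ + 1)` gives `2^k ≥ m^2` yet stays `O(log m)`, so `1/m` and the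
excess of `log log n` over `log m` are both negligible. -/
theorem exists_tendsto_regularCount_le :
    ∃ h : ℕ → ℝ, Tendsto h atTop (𝓝 (Real.exp (-Real.eulerMascheroniConstant))) ∧
      ∀ᶠ m in atTop,
        (regularCount (primorial m ^ (2 * (Nat.log 2 m + 1))) : ℝ) *
          Real.log (Real.log ((primorial m ^ (2 * (Nat.log 2 m + 1)) : ℕ) : ℝ)) /
            ((primorial m ^ (2 * (Nat.log 2 m + 1)) : ℕ) : ℝ) ≤ h m := by
  refine ⟨fun m => (∏ p ∈ Nat.primesLE m, (1 - (p : ℝ)⁻¹) + 1 / m) *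
    (Real.log m + (Real.log 12 + Real.log (Real.log m))), ?_, ?_⟩
  · have hlog : Tendsto (fun x : ℝ => Real.log x / x) atTop (𝓝 0) :=
      Real.isLittleO_log_id_atTop.tendsto_div_nhds_zero
    have h1 : Tendsto (fun m : ℕ => Real.log m / m) atTop (𝓝 0) :=
      hlog.comp tendsto_natCast_atTop_atTop
    have h2 : Tendsto (fun m : ℕ => Real.log (Real.log m) / Real.log m) atTop (𝓝 0) :=
      hlog.comp tendsto_log_natCast_atTop
    have h3 := tendsto_log_natCast_atTop.const_div_atTop (Real.log 12)
    have := (tendsto_prod_one_sub_inv_mul_log.add h1).mul ((h3.add h2).const_add 1)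
    simp only [add_zero, mul_one] at this
    refine this.congr' ?_
    filter_upwards [eventually_ge_atTop 2] with m hm
    have hlm : Real.log m ≠ 0 := (Real.log_pos (by exact_mod_cast (by omega : 1 < m))).ne'
    have hm0 : (m : ℝ) ≠ 0 := by exact_mod_cast (by omega : m ≠ 0)
    field_simp
  · filter_upwards [eventually_ge_atTop 3, tendsto_primorial_pow_log_atTop.eventually
      (tendsto_log_log_natCast_atTop.eventually_ge_atTop 0)] with m hm hpos
    have hlm : 1 ≤ Real.log m := by
      rw [Real.le_log_iff_exp_le (by positivity)]
      have : (3 : ℝ) ≤ m := by exact_mod_cast hm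
      linarith [Real.exp_one_lt_d9]
    have hpow : m ^ 2 ≤ 2 ^ (2 * (Nat.log 2 m + 1)) := by
      rw [mul_comm, pow_mul]
      exact Nat.pow_le_pow_left (Nat.lt_pow_succ_log_self one_lt_two m).le 2
    have hk : ((2 * (Nat.log 2 m + 1) : ℕ) : ℝ) ≤ 6 * Real.log m := by
      have h1 : (Nat.log 2 m : ℝ) * Real.log 2 ≤ Real.log m := by
        rw [← Real.log_pow]
        exact Real.log_le_log (by positivity)
          (by exact_mod_cast Nat.pow_log_le_self 2 (by omega))
      have h2 := Real.log_two_gt_d9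
      have h3 : (0 : ℝ) ≤ Nat.log 2 m := Nat.cast_nonneg _
      push_cast
      nlinarith
    have hA := regularCount_primorial_pow_div_le (m := m) (by omega) (by omega) hpow
    have hB := log_log_primorial_pow_le hm (by omega) hk
    rw [mul_div_right_comm]
    refine mul_le_mul hA hB hpos (le_trans (by positivity) hA)

/-! ### The two lower limits -/

theorem theorem7 :
    Filter.liminf
        (fun n : ℕ =>
          (((regularCount n : ℝ) * Real.log (Real.log (n : ℝ)) / (n : ℝ) : ℝ) : EReal))
        Filter.atTop
      = ((Real.exp (-Real.eulerMascheroniConstant) : ℝ) : EReal) ∧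
    Filter.liminf
        (fun n : ℕ =>
          (((Nat.totient n : ℝ) * Real.log (Real.log (n : ℝ)) / (n : ℝ) : ℝ) : EReal))
        Filter.atTop
      = ((Real.exp (-Real.eulerMascheroniConstant) : ℝ) : EReal) := by
  obtain ⟨g, hg, hgle⟩ := exists_tendsto_le_totient_mul_log_log_div
  obtain ⟨h, hh, hhle⟩ := exists_tendsto_regularCount_le
  have hlower : ((Real.exp (-Real.eulerMascheroniConstant) : ℝ) : EReal) ≤ liminf
      (fun n : ℕ =>
        (((Nat.totient n : ℝ) * Real.log (Real.log (n : ℝ)) / (n : ℝ) : ℝ) : EReal)) atTop := by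
    rw [← (EReal.tendsto_coe.2 hg).liminf_eq]
    exact liminf_le_liminf (hgle.mono fun n hn => EReal.coe_le_coe_iff.2 hn)
  have hmid : liminf
      (fun n : ℕ =>
        (((Nat.totient n : ℝ) * Real.log (Real.log (n : ℝ)) / (n : ℝ) : ℝ) : EReal)) atTop ≤
      liminf (fun n : ℕ =>
        (((regularCount n : ℝ) * Real.log (Real.log (n : ℝ)) / (n : ℝ) : ℝ) : EReal)) atTop := by
    refine liminf_le_liminf ?_
    filter_upwards [tendsto_log_log_natCast_atTop.eventually_ge_atTop 0] with n hn
    rw [EReal.coe_le_coe_iff]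
    have : (Nat.totient n : ℝ) ≤ regularCount n := by exact_mod_cast totient_le_regularCount n
    gcongr
  have hupper : liminf (fun n : ℕ =>
        (((regularCount n : ℝ) * Real.log (Real.log (n : ℝ)) / (n : ℝ) : ℝ) : EReal)) atTop ≤
      ((Real.exp (-Real.eulerMascheroniConstant) : ℝ) : EReal) := by
    rw [← (EReal.tendsto_coe.2 hh).liminf_eq]
    -- A lower limit can only grow on passing to the primorial powers.
    refine tendsto_primorial_pow_log_atTop.liminf_le_liminf_comp.trans ?_
    exact liminf_le_liminf (hhle.mono fun m hm => EReal.coe_le_coe_iff.2 hm)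
  exact ⟨le_antisymm hupper (hlower.trans hmid), le_antisymm (hmid.trans hupper) hlower⟩
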